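/- Let $A_1,\dots,A_s\in\mathbb R^{n\times n}$ and $B_1,\dots,B_s\in\mathbb R^{n\times p}$ be the state and input matrices of a Markov jump system with $s$ modes whose mode sequence is a Markov chain with irreducible (in particular, any ergodic) transition matrix $T\in\mathbb R^{s\times s}$. An $r$-cluster partition of $[s]=\{1,\dots,s\}$ is a family of $r$ pairwise disjoint nonempty sets with union $[s]$. Let $\Omega_{1:r}=\{\Omega_1,\dots,\Omega_r\}$ be an $r$-cluster partition of $[s]$ and $\epsilon_A,\epsilon_B,\epsilon_T\ge 0$ be such that $$\sum_{k\in[r]}\sum_{i,i'\in\Omega_k}\|A_i-A_{i'}\|_F\le\epsilon_A,\qquad \sum_{k\in[r]}\sum_{i,i'\in\Omega_k}\|B_i-B_{i'}\|_F\le\epsilon_B,\qquad \sum_{k\in[r]}\sum_{i,i'\in\Omega_k}\|T(i,:)-T(i',:)\|_1\le\epsilon_T .$$ Let $\alpha_A,\alpha_B,\alpha_T\ge 0$ with $\alpha_A+\alpha_B+\alpha_T=1$, and let $\Phi$ be the feature matrix with rows $$\Phi(i,:)=[\alpha_A\,\mathrm{vec}(A_i)^{\top},\ \alpha_B\,\mathrm{vec}(B_i)^{\top},\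 \alpha_T\,T(i,:)],\qquad i\in[s].$$ Let the columns of $U_r\in\mathbb R^{s\times r}$ be (orthonormal) top $r$ left singular vectors of $\Phi$. Let $\epsilon\ge 0$, and let the $r$-cluster partition $\hat\Omega_{1:r}$ of $[s]$ with centers $\hat c_1,\dots,\hat c_r\in\mathbb R^r$ be a $(1+\epsilon)$-approximate k-means solution on the rows of $U_r$: $$\sum_{k\in[r]}\sum_{i\in\hat\Omega_k}\|U_r(i,:)-\hat c_k\|^2\le(1+\epsilon)\min_{\Omega'_{1:r},\,c'_{1:r}}\ \sum_{k\in[r]}\sum_{i\in\Omega'_k}\|U_r(i,:)-c'_k\|^2,$$ the minimum being over all $r$-cluster partitions $\Omega'_{1:r}$ of $[s]$ and all centers $c'_1,\dots,c'_r\in\mathbb R^r$. The misclustering rate is $$\mathrm{MR}(\hat\Omega_{1:r})=\min_{h}\sum_{k\in[r]}\frac{|\{i: i\in\Omega_k,\ i\notin\hat\Omega_{h(k)}\}|}{|\Omega_k|},$$ the minimum being over all bijections $h:[r]\to[r]$. Let $\bar\Phi$ be the averaged feature matrix, $\bar\Phi(i,:)=|\Omega_k|^{-1}\sum_{i'\in\Omega_k}\Phi(i',:)$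 for $i\in\Omega_k$, let $\sigma_r(\bar\Phi)$ be its $r$-th largest singular value, let $|\Omega_{(1)}|$ and $|\Omega_{(r)}|$ be the largest and the smallest of the cluster sizes $|\Omega_1|,\dots,|\Omega_r|$, and let $$\epsilon_{Agg}=\sqrt{\alpha_A^2\epsilon_A^2+\alpha_B^2\epsilon_B^2+\alpha_T^2\epsilon_T^2}.$$ Assume $\mathrm{rank}(\bar\Phi)=r$. If $$\epsilon_{Agg}\le\frac{\sigma_r(\bar\Phi)\sqrt{|\Omega_{(r)}|+|\Omega_{(1)}|}}{8\sqrt{(2+\epsilon)|\Omega_{(1)}|}},$$ then $$\mathrm{MR}(\hat\Omega_{1:r})\le 64(2+\epsilon)\,\sigma_r(\bar\Phi)^{-2}\,\epsilon_{Agg}^2 .$$ Additionally, if $$\epsilon_{Agg}\le\frac{\sigma_r(\bar\Phi)}{8\sqrt{(2+\epsilon)|\Omega_{(1)}|}},$$ then $\mathrm{MR}(\hat\Omega_{1:r})=0$. -/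

import Mathlib

namespace MJSReduction

open scoped Matrix

/-- A Markov jump system `x_{t+1} = A_{ω_t} x_t + B_{ω_t} u_t` with state dimension `n`, input
dimension `p` and `s` modes, where `ω_t` is a Markov chain with transition matrix `T`.
Of ergodicity only irreducibility is required (aperiodicity is not). -/
structure MJS (n p s : ℕ) where
  A : Fin s → Matrix (Fin n) (Fin n) ℝ
  B : Fin s → Matrix (Fin n) (Fin p) ℝ
  T : Matrix (Fin s) (Fin s) ℝ
  stochastic : T ∈ Matrix.rowStochastic ℝ (Fin s)
  irreducible : T.IsIrreducible

/-- `Ω` is an `r`-cluster partition of the `s` modes. -/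
structure IsPartition {r s : ℕ} (Ω : Fin r → Finset (Fin s)) : Prop where
  cover : ∀ i, ∃ k, i ∈ Ω k
  disjoint : ∀ k l, k ≠ l → Disjoint (Ω k) (Ω l)
  nonempty : ∀ k, (Ω k).Nonempty

/-- The size of the largest cluster. -/
noncomputable def maxClusterCard {r s : ℕ} (Ω : Fin r → Finset (Fin s)) : ℕ :=
  ⨆ k, (Ω k).card

/-- The size of the smallest cluster. -/
noncomputable def minClusterCard {r s : ℕ} (Ω : Fin r → Finset (Fin s)) : ℕ :=
  ⨅ k, (Ω k).card

section Perturbation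

open scoped Matrix.Norms.Frobenius

/-- The aggregatable case: `Ω` is a partition of the modes, and `εA, εB, εT` bound the total
within-cluster differences (Frobenius norm for `A_i` and `B_i`, `ℓ¹` norm for the rows of `T`,
sums over ordered pairs). -/
structure IsAggregatableCase {n p s r : ℕ} (S : MJS n p s) (Ω : Fin r → Finset (Fin s))
    (εA εB εT : ℝ) : Prop where
  isPartition : IsPartition Ω
  nonneg_A : 0 ≤ εA
  nonneg_B : 0 ≤ εB
  nonneg_T : 0 ≤ εT
  bound_A : ∑ k, ∑ i ∈ Ω k, ∑ i' ∈ Ω k, ‖S.A i - S.A i'‖ ≤ εA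
  bound_B : ∑ k, ∑ i ∈ Ω k, ∑ i' ∈ Ω k, ‖S.B i - S.B i'‖ ≤ εB
  bound_T : ∑ k, ∑ i ∈ Ω k, ∑ i' ∈ Ω k, ∑ j, |S.T i j - S.T i' j| ≤ εT

end Perturbation

/-- The columns of the feature matrix: entries of `vec A_i`, of `vec B_i`, and of `T(i,:)`. -/
abbrev FeatureIndex (n p s : ℕ) : Type := (Fin n × Fin n) ⊕ (Fin p × Fin n) ⊕ Fin s

/-- The feature matrix with rows `[αA vec(A_i)ᵀ, αB vec(B_i)ᵀ, αT T(i,:)]`. -/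
def featureMatrix {n p s : ℕ} (S : MJS n p s) (αA αB αT : ℝ) :
    Matrix (Fin s) (FeatureIndex n p s) ℝ :=
  Matrix.of fun i => Sum.elim (αA • (S.A i).vec) (Sum.elim (αB • (S.B i).vec) (αT • S.T i))

/-- Every row is replaced by the average of the rows of its cluster
(for a partition exactly one summand is active for each row). -/
noncomputable def averagedMatrix {s r : ℕ} {κ : Type*} (Ω : Fin r → Finset (Fin s))
    (Φ : Matrix (Fin s) κ ℝ) : Matrix (Fin s) κ ℝ :=
  Matrix.of fun i j =>
    ∑ k, if i ∈ Ω k then ((Ω k).card : ℝ)⁻¹ * ∑ i' ∈ Ω k, Φ i' j else 0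

/-- The `i`-th largest singular value of `M`, for `i ≥ 1` (Mathlib counts from `0`). -/
noncomputable def singularValue {s : ℕ} {κ : Type*} [Fintype κ] [DecidableEq κ]
    (M : Matrix (Fin s) κ ℝ) (i : ℕ) : ℝ :=
  (Matrix.toEuclideanLin M).singularValues (i - 1)

/-- The columns of `U` are top `r` left singular vectors of `Φ`: they are the first `r` columns
of an orthogonal `W` that is the left factor of a singular value decomposition of `Φ` with
singular values in decreasing order (padded by zeros), i.e. `Φ Φᵀ = W diag(σ²) Wᵀ`. -/
def IsTopLeftSingularVectors {s r : ℕ} {κ : Type*} [Fintype κ]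
    (Φ : Matrix (Fin s) κ ℝ) (U : Matrix (Fin s) (Fin r) ℝ) : Prop :=
  ∃ (W : Matrix (Fin s) (Fin s) ℝ) (σ : Fin s → ℝ) (hrs : r ≤ s),
    W ∈ Matrix.orthogonalGroup (Fin s) ℝ ∧ Antitone σ ∧ (∀ j, 0 ≤ σ j) ∧
    Φ * Φᵀ = W * Matrix.diagonal (fun j => σ j ^ 2) * Wᵀ ∧
    ∀ i j, U i j = W i (Fin.castLE hrs j)

/-- The k-means objective on the rows of `U`. -/
noncomputable def kmeansCost {s r d : ℕ} (U : Matrix (Fin s) (Fin d) ℝ)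
    (Ω : Fin r → Finset (Fin s)) (c : Fin r → EuclideanSpace ℝ (Fin d)) : ℝ :=
  ∑ k, ∑ i ∈ Ω k, ‖WithLp.toLp 2 (U i) - c k‖ ^ 2

/-- `(Ω, c)` is a `(1 + ε)`-approximate solution of the k-means problem on the rows of `U`. -/
def IsApproxKMeans {s r d : ℕ} (ε : ℝ) (U : Matrix (Fin s) (Fin d) ℝ)
    (Ω : Fin r → Finset (Fin s)) (c : Fin r → EuclideanSpace ℝ (Fin d)) : Prop :=
  IsPartition Ω ∧
    ∀ (Ω' : Fin r → Finset (Fin s)) (c' : Fin r → EuclideanSpace ℝ (Fin d)),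
      IsPartition Ω' → kmeansCost U Ω c ≤ (1 + ε) * kmeansCost U Ω' c'

/-- The clustering steps of the reduction algorithm in the aggregatable case: `U` holds top `r`
left singular vectors of the feature matrix and `(Ωhat, c)` is a `(1 + ε)`-approximate k-means
solution on the rows of `U`. -/
structure IsAlgorithmOutput {n p s r : ℕ} (S : MJS n p s) (αA αB αT ε : ℝ)
    (U : Matrix (Fin s) (Fin r) ℝ) (Ωhat : Fin r → Finset (Fin s))
    (c : Fin r → EuclideanSpace ℝ (Fin r)) : Prop where
  singularVectors : IsTopLeftSingularVectors (featureMatrix S αA αB αT) U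
  kmeans : IsApproxKMeans ε U Ωhat c

/-- The misclustering rate, a minimum over all bijections of the cluster labels. -/
noncomputable def misclusteringRate {s r : ℕ} (Ω Ωhat : Fin r → Finset (Fin s)) : ℝ :=
  Finset.univ.inf' Finset.univ_nonempty fun h : Equiv.Perm (Fin r) =>
    ∑ k, ((Ω k \ Ωhat (h k)).card : ℝ) / ((Ω k).card : ℝ)

/-- The aggregate perturbation. -/
noncomputable def epsAgg (αA αB αT εA εB εT : ℝ) : ℝ :=
  √(αA ^ 2 * εA ^ 2 + αB ^ 2 * εB ^ 2 + αT ^ 2 * εT ^ 2)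

end MJSReduction

open MJSReduction

namespace MJSReduction

open scoped Matrix
open Finset

/-! Let `Z` be the matrix of normalized cluster indicators, so that `P = Z * Zᵀ` is the orthogonal
projection with `P * Φ` the averaged matrix, and let `δ` be the squared Frobenius norm of `(1 - U *
Uᵀ) * P`. A Davis–Kahan type bound gives `σ_r² δ ≤ 4 ‖Φ - P Φ‖² ≤ 4 ε_Agg²`: `U` captures at least
as much of `Φ` as `Z` does (Ky Fan, `IsTopLeftSingularVectors.trace_le`), and the rank hypothesis
makes `P * Φ` and `P` have the same range (`singularValue_sq_mul_frobSq_le`).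

Let `C` be the matrix of estimated centers. The true partition with its cluster means competes in
k-means at cost `δ`, whence `‖C Uᵀ - P‖² ≤ 3 (2 + ε) δ`. Working with `C * Uᵀ` and `P` removes the
need to align `U` with `Z` by a rotation.

Rows of `P` from clusters `k ≠ l` are at squared distance `1/|Ω_k| + 1/|Ω_l|`, while modes sharing
an estimated cluster share a row of `C * Uᵀ`. Hence only modes with a large row deviation `D i` can
be misplaced, and these are counted by a Markov inequality (`IsPartition.misclusteringRate_le_sum`,
`IsPartition.misclusteringRate_eq_zero`). -/

/-- The squared Frobenius norm. -/
def frobSq {m κ : Type*} [Fintype m] [Fintype κ] (M : Matrix m κ ℝ) : ℝ :=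
  ∑ i, ∑ j, M i j ^ 2

/-! ### Frobenius norms and orthogonal projections. -/

section FrobSq

variable {m κ ι : Type*} [Fintype m] [Fintype κ] [Fintype ι]

theorem frobSq_nonneg (M : Matrix m κ ℝ) : 0 ≤ frobSq M :=
  sum_nonneg fun _ _ => sum_nonneg fun _ _ => sq_nonneg _

theorem frobSq_eq_trace (M : Matrix m κ ℝ) : frobSq M = (M * Mᵀ).trace := by
  simp [frobSq, Matrix.trace, Matrix.mul_apply, sq]

theorem frobSq_add_le (M N : Matrix m κ ℝ) : frobSq (M + N) ≤ 2 * frobSq M + 2 * frobSq N := by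
  simp only [frobSq, mul_sum, ← sum_add_distrib, Matrix.add_apply]
  gcongr with i _ j _
  nlinarith [sq_nonneg (M i j - N i j)]

theorem frobSq_sub_le (M N : Matrix m κ ℝ) : frobSq (M - N) ≤ 2 * frobSq M + 2 * frobSq N := by
  have h := frobSq_add_le M (-N)
  simpa [← sub_eq_add_neg, frobSq] using h

theorem frobSq_mul_transpose_of_transpose_mul_self [DecidableEq ι] {U : Matrix κ ι ℝ}
    (hU : Uᵀ * U = 1) (M : Matrix m ι ℝ) : frobSq (M * Uᵀ) = frobSq M := by
  rw [frobSq_eq_trace, frobSq_eq_trace, Matrix.transpose_mul, Matrix.transpose_transpose,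
    Matrix.mul_assoc, ← Matrix.mul_assoc Uᵀ, hU, Matrix.one_mul]

theorem frobSq_mul_of_symm_idem {Q : Matrix m m ℝ} (hs : Qᵀ = Q) (hi : Q * Q = Q)
    (M : Matrix m κ ℝ) : frobSq (Q * M) = (Q * (M * Mᵀ)).trace := by
  rw [frobSq_eq_trace, Matrix.transpose_mul, hs, Matrix.trace_mul_comm]
  rw [← Matrix.mul_assoc, Matrix.mul_assoc _ Q Q, hi, Matrix.trace_mul_comm, ← Matrix.mul_assoc,
    Matrix.trace_mul_comm]

theorem frobSq_one_sub_mul [DecidableEq m] {Q : Matrix m m ℝ} (hs : Qᵀ = Q) (hi : Q * Q = Q)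
    (M : Matrix m κ ℝ) : frobSq ((1 - Q) * M) = frobSq M - (Q * (M * Mᵀ)).trace := by
  rw [frobSq_mul_of_symm_idem (by simp [hs]) (by simp [Matrix.sub_mul, Matrix.mul_sub, hi]),
    Matrix.sub_mul, Matrix.trace_sub, Matrix.one_mul, frobSq_eq_trace]

theorem frobSq_one_sub_mul_le [DecidableEq m] {Q : Matrix m m ℝ} (hs : Qᵀ = Q) (hi : Q * Q = Q)
    (M : Matrix m κ ℝ) : frobSq ((1 - Q) * M) ≤ frobSq M := by
  rw [frobSq_one_sub_mul hs hi, ← frobSq_mul_of_symm_idem hs hi]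
  linarith [frobSq_nonneg (Q * M)]

end FrobSq

/-! ### The smallest nonzero singular value. -/

section SingularValue

open Module InnerProductSpace

/-- In an eigenbasis of `T* T` the two sides are weighted sums with weights `σ_rank² σ_j²` and
`σ_j⁴`. Indices beyond the rank contribute zero to both; the `- 1` reflects counting from zero. -/
theorem sq_singularValues_mul_norm_sq_le {E F : Type*} [NormedAddCommGroup E]
    [InnerProductSpace ℝ E] [FiniteDimensional ℝ E] [NormedAddCommGroup F]
    [InnerProductSpace ℝ F] [FiniteDimensional ℝ F] (T : E →ₗ[ℝ] F) (x : E) :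
    T.singularValues (finrank ℝ T.range - 1) ^ 2 * ‖T x‖ ^ 2 ≤ ‖T.adjoint (T x)‖ ^ 2 := by
  have hT := T.isSymmetric_adjoint_comp_self
  let b := hT.eigenvectorBasis rfl
  have hrepr : ∀ j, b.repr (T.adjoint (T x)) j = T.singularValues j ^ 2 * b.repr x j := fun j => by
    rw [T.sq_singularValues_fin rfl]
    exact hT.eigenvectorBasis_apply_self_apply rfl x j
  have h1 : ‖T x‖ ^ 2 = ∑ j : Fin _, T.singularValues j ^ 2 * (b.repr x j) ^ 2 := by
    rw [← real_inner_self_eq_norm_sq, ← LinearMap.adjoint_inner_left, ← b.repr.inner_map_map,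
      PiLp.inner_apply]
    refine sum_congr rfl fun j _ => ?_
    rw [hrepr]
    simp; ring
  have h2 : ‖T.adjoint (T x)‖ ^ 2 =
      ∑ j : Fin _, (T.singularValues j ^ 2 * b.repr x j) ^ 2 := by
    rw [← b.repr.norm_map, EuclideanSpace.norm_sq_eq]
    exact sum_congr rfl fun j _ => by rw [hrepr, Real.norm_eq_abs, sq_abs]
  rw [h1, h2, mul_sum]
  refine sum_le_sum fun j _ => ?_
  by_cases hj : (j : ℕ) < finrank ℝ T.range
  · have h3 : T.singularValues (finrank ℝ T.range - 1) ≤ T.singularValues j :=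
      T.singularValues_antitone (by omega)
    have h4 := pow_le_pow_left₀ (T.singularValues_nonneg _) h3 2
    have h5 := mul_le_mul_of_nonneg_right h4
      (mul_nonneg (sq_nonneg (T.singularValues j)) (sq_nonneg (b.repr x j)))
    linarith
  · rw [T.singularValues_eq_zero_iff_le_finrank_range.2 (not_lt.1 hj)]
    simp

variable {s : ℕ} {κ : Type*} [Fintype κ] [DecidableEq κ]

theorem finrank_range_toEuclideanLin (M : Matrix (Fin s) κ ℝ) :
    finrank ℝ (Matrix.toEuclideanLin M).range = M.rank := by
  rw [Matrix.toEuclideanLin_eq_toLin_orthonormal]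
  exact (Matrix.rank_eq_finrank_range_toLin _ _ _).symm

theorem singularValue_rank_pos (M : Matrix (Fin s) κ ℝ) (hM : 0 < M.rank) :
    0 < singularValue M M.rank := by
  rw [singularValue, LinearMap.singularValues_pos_iff_lt_finrank_range,
    finrank_range_toEuclideanLin]
  omega

theorem singularValue_rank_sq_mul_le (M : Matrix (Fin s) κ ℝ) (x : κ → ℝ) :
    singularValue M M.rank ^ 2 * ∑ i, (M *ᵥ x) i ^ 2 ≤ ∑ j, (Mᵀ *ᵥ (M *ᵥ x)) j ^ 2 := by
  have h := sq_singularValues_mul_norm_sq_le (Matrix.toEuclideanLin M) (WithLp.toLp 2 x)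
  rw [← Matrix.toEuclideanLin_conjTranspose_eq_adjoint, finrank_range_toEuclideanLin,
    EuclideanSpace.norm_sq_eq, EuclideanSpace.norm_sq_eq] at h
  simpa [singularValue, Matrix.toLpLin_apply, Matrix.conjTranspose_eq_transpose_of_trivial] using h

/-- The rank condition forces `M` and `Q` to have the same range, so each row of `Y * Q` is some `M
x`. Since `Mᵀ Q = Mᵀ`, the vector `Mᵀ (M x)` is the corresponding row of `Y * M`. -/
theorem singularValue_sq_mul_frobSq_le (M : Matrix (Fin s) κ ℝ) {Q : Matrix (Fin s) (Fin s) ℝ}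
    (hs : Qᵀ = Q) (hQM : Q * M = M) (hrank : Q.rank ≤ M.rank) (Y : Matrix (Fin s) (Fin s) ℝ) :
    singularValue M M.rank ^ 2 * frobSq (Y * Q) ≤ frobSq (Y * M) := by
  have hle : M.mulVecLin.range ≤ Q.mulVecLin.range := by
    rw [← hQM, Matrix.mulVecLin_mul]
    exact LinearMap.range_comp_le_range _ _
  have heq : M.mulVecLin.range = Q.mulVecLin.range :=
    Submodule.eq_of_le_of_finrank_le hle hrank
  rw [frobSq, frobSq, mul_sum]
  refine sum_le_sum fun i _ => ?_
  have hmem : Q *ᵥ Y i ∈ M.mulVecLin.range := heq ▸ ⟨Y i, rfl⟩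
  obtain ⟨x, hx⟩ := hmem
  rw [Matrix.mulVecLin_apply] at hx
  have h := singularValue_rank_sq_mul_le M x
  rw [hx, Matrix.mulVec_mulVec] at h
  have h1 : Mᵀ * Q = Mᵀ := by
    conv_rhs => rw [← hQM, Matrix.transpose_mul, hs]
  have h2 : ∀ j, (Y * Q) i j = (Q *ᵥ Y i) j := fun j => by
    conv_rhs => rw [← hs, Matrix.mulVec_transpose]
    rfl
  have h3 : ∀ j, (Y * M) i j = (Mᵀ *ᵥ Y i) j := fun j => by
    rw [Matrix.mulVec_transpose]
    rfl
  rw [h1] at h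
  simpa only [h2, h3] using h

end SingularValue

/-! ### Ky Fan's principle and the subspace perturbation bound. -/

section TopSingularVectors

variable {s r : ℕ} {κ : Type*} [Fintype κ]

/-- Bathtub principle: weights in `[0, 1]` of total mass `r` do best on the `r` largest values. The
proof compares every `D j` with the threshold value `D top`. -/
theorem sum_mul_le_sum_castLE {D g : Fin s → ℝ} (hD : Antitone D) (hr : 0 < r) (hrs : r ≤ s)
    (hg0 : ∀ j, 0 ≤ g j) (hg1 : ∀ j, g j ≤ 1) (hg : ∑ j, g j = r) :
    ∑ j, D j * g j ≤ ∑ k, D (Fin.castLE hrs k) := by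
  let top : Fin s := ⟨r - 1, by omega⟩
  let e : Fin s → ℝ := fun j => ∑ k, if Fin.castLE hrs k = j then 1 else 0
  have he : ∀ f : Fin s → ℝ, ∑ j, f j * e j = ∑ k, f (Fin.castLE hrs k) := fun f => by
    simp only [e, mul_sum]
    rw [sum_comm]
    simp
  have he1 : ∑ j, e j = r := by simpa using he fun _ => 1
  have key : ∀ j, D top * (e j - g j) ≤ D j * (e j - g j) := fun j => by
    by_cases hj : (j : ℕ) < r
    · have hej : e j = 1 := by
        have : ∀ k, Fin.castLE hrs k = j ↔ k = ⟨j, hj⟩ := fun k => by simp [Fin.ext_iff]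
        simp only [e, this, sum_ite_eq', mem_univ, if_true]
      have : D top ≤ D j := hD (Fin.le_def.2 (by simp only [top]; omega))
      exact mul_le_mul_of_nonneg_right this (by linarith [hg1 j])
    · have hej : e j = 0 := sum_eq_zero fun k _ => if_neg fun h => hj (by
        rw [← h]; exact k.2)
      have : D j ≤ D top := hD (Fin.le_def.2 (by simp only [top]; omega))
      exact mul_le_mul_of_nonpos_right this (by linarith [hg0 j])
  have h := sum_le_sum fun j (_ : j ∈ univ) => key j
  rw [← mul_sum, sum_sub_distrib, he1, hg, sub_self, mul_zero] at h
  simp only [mul_sub, sum_sub_distrib] at h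
  rw [he] at h
  linarith

theorem mul_transpose_idem {m : Type*} [Fintype m] {Z : Matrix m (Fin r) ℝ} (hZ : Zᵀ * Z = 1) :
    Z * Zᵀ * (Z * Zᵀ) = Z * Zᵀ := by
  rw [Matrix.mul_assoc, ← Matrix.mul_assoc Zᵀ, hZ, Matrix.one_mul]

theorem mul_transpose_symm {m : Type*} (Z : Matrix m (Fin r) ℝ) :
    (Z * Zᵀ)ᵀ = Z * Zᵀ := by simp

theorem trace_mul_transpose {m : Type*} [Fintype m] {Z : Matrix m (Fin r) ℝ} (hZ : Zᵀ * Z = 1) :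
    (Z * Zᵀ).trace = r := by
  rw [Matrix.trace_mul_comm, hZ, Matrix.trace_one, Fintype.card_fin]

/-- A diagonal entry of a symmetric idempotent is the sum of squares of its row, hence at least its
own square. -/
theorem mul_transpose_diag_le_one {m : Type*} [Fintype m] {Z : Matrix m (Fin r) ℝ}
    (hZ : Zᵀ * Z = 1) (j : m) : (Z * Zᵀ) j j ≤ 1 := by
  have h : (Z * Zᵀ) j j = ∑ l, (Z * Zᵀ) j l ^ 2 := by
    conv_lhs => rw [← mul_transpose_idem hZ, Matrix.mul_apply]
    refine sum_congr rfl fun l _ => ?_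
    rw [sq, ← Matrix.transpose_apply (Z * Zᵀ) j l, mul_transpose_symm]
  have h1 : (Z * Zᵀ) j j ^ 2 ≤ (Z * Zᵀ) j j := by
    conv_rhs => rw [h]
    exact single_le_sum (f := fun l => (Z * Zᵀ) j l ^ 2) (fun _ _ => sq_nonneg _) (mem_univ j)
  nlinarith [sq_nonneg ((Z * Zᵀ) j j - 1)]

theorem trace_mul_diagonal_conj (V : Matrix (Fin s) (Fin r) ℝ) (W : Matrix (Fin s) (Fin s) ℝ)
    (D : Fin s → ℝ) : (V * Vᵀ * (W * Matrix.diagonal D * Wᵀ)).trace =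
      ∑ j, D j * (Wᵀ * V * (Wᵀ * V)ᵀ) j j := by
  have : (V * Vᵀ * (W * Matrix.diagonal D * Wᵀ)).trace =
      (Matrix.diagonal D * (Wᵀ * V * (Wᵀ * V)ᵀ)).trace := by
    rw [← Matrix.mul_assoc, Matrix.trace_mul_comm, ← Matrix.mul_assoc, ← Matrix.mul_assoc,
      ← Matrix.mul_assoc, Matrix.trace_mul_comm]
    simp [Matrix.mul_assoc]
  rw [this]
  simp [Matrix.trace, Matrix.diagonal_mul]

theorem IsTopLeftSingularVectors.transpose_mul_self {Φ : Matrix (Fin s) κ ℝ}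
    {U : Matrix (Fin s) (Fin r) ℝ} (h : IsTopLeftSingularVectors Φ U) : Uᵀ * U = 1 := by
  obtain ⟨W, σ, hrs, hW, -, -, -, hU⟩ := h
  have hW' : Wᵀ * W = 1 := by simpa [Matrix.star_eq_conjTranspose] using hW.1
  ext k l
  have := congrFun (congrFun hW' (Fin.castLE hrs k)) (Fin.castLE hrs l)
  simp only [Matrix.mul_apply, Matrix.transpose_apply, Matrix.one_apply, Fin.castLE_inj] at this ⊢
  simpa [hU] using this

/-- In the basis `W` the trace is `∑ σ_j² g_j`, with `g` the diagonal of the rank `r` projection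
onto the span of `Wᵀ * Z`. For `U` these weights are the indicator of the first `r` indices, the
extremal case of `sum_mul_le_sum_castLE`. -/
theorem IsTopLeftSingularVectors.trace_le {Φ : Matrix (Fin s) κ ℝ}
    {U : Matrix (Fin s) (Fin r) ℝ} (h : IsTopLeftSingularVectors Φ U) (hr : 0 < r)
    {Z : Matrix (Fin s) (Fin r) ℝ} (hZ : Zᵀ * Z = 1) :
    (Z * Zᵀ * (Φ * Φᵀ)).trace ≤ (U * Uᵀ * (Φ * Φᵀ)).trace := by
  obtain ⟨W, σ, hrs, hW, hσ, hσ0, hΦ, hU⟩ := h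
  have hW1 : Wᵀ * W = 1 := by simpa [Matrix.star_eq_conjTranspose] using hW.1
  have hW2 : W * Wᵀ = 1 := by simpa [Matrix.star_eq_conjTranspose] using hW.2
  have hD : Antitone fun j => σ j ^ 2 := fun i j hij => pow_le_pow_left₀ (hσ0 j) (hσ hij) 2
  have hN : (Wᵀ * Z)ᵀ * (Wᵀ * Z) = 1 := by
    rw [Matrix.transpose_mul, Matrix.transpose_transpose, Matrix.mul_assoc,
      ← Matrix.mul_assoc W, hW2, Matrix.one_mul, hZ]
  have hWU : ∀ j k, (Wᵀ * U) j k = if Fin.castLE hrs k = j then 1 else 0 := fun j k => by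
    have := congrFun (congrFun hW1 j) (Fin.castLE hrs k)
    simp only [Matrix.mul_apply, Matrix.transpose_apply, Matrix.one_apply] at this ⊢
    simpa [hU, eq_comm] using this
  rw [hΦ, trace_mul_diagonal_conj, trace_mul_diagonal_conj]
  have hR : ∑ j, σ j ^ 2 * (Wᵀ * U * (Wᵀ * U)ᵀ) j j = ∑ k, σ (Fin.castLE hrs k) ^ 2 := by
    simp only [Matrix.mul_apply (M := Wᵀ * U), Matrix.transpose_apply (Wᵀ * U), hWU, mul_sum]
    rw [sum_comm]
    simp
  rw [hR]
  refine sum_mul_le_sum_castLE hD hr hrs (fun j => ?_) (mul_transpose_diag_le_one hN)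
    (trace_mul_transpose hN)
  rw [Matrix.mul_apply]
  exact sum_nonneg fun k _ => mul_self_nonneg _

variable [DecidableEq κ]

/-- The part of the orthogonal projection onto the span of `Z` that is missed by the projection
onto the top left singular vectors is controlled by the distance of `Φ` from that span. -/
theorem IsTopLeftSingularVectors.frobSq_one_sub_mul_le {Φ : Matrix (Fin s) κ ℝ}
    {U : Matrix (Fin s) (Fin r) ℝ} (h : IsTopLeftSingularVectors Φ U) (hr : 0 < r)
    {Z : Matrix (Fin s) (Fin r) ℝ} (hZ : Zᵀ * Z = 1) (hrank : (Z * Zᵀ * Φ).rank = r) :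
    singularValue (Z * Zᵀ * Φ) r ^ 2 * frobSq ((1 - U * Uᵀ) * (Z * Zᵀ)) ≤
      4 * frobSq (Φ - Z * Zᵀ * Φ) := by
  have hU := h.transpose_mul_self
  have hE : Φ - Z * Zᵀ * Φ = (1 - Z * Zᵀ) * Φ := by rw [Matrix.sub_mul, Matrix.one_mul]
  -- By Pythagoras, capturing more trace means leaving a smaller residual.
  have h1 : frobSq ((1 - U * Uᵀ) * Φ) ≤ frobSq (Φ - Z * Zᵀ * Φ) := by
    rw [hE, frobSq_one_sub_mul (mul_transpose_symm U) (mul_transpose_idem hU),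
      frobSq_one_sub_mul (mul_transpose_symm Z) (mul_transpose_idem hZ)]
    linarith [h.trace_le hr hZ]
  have h2 : frobSq ((1 - U * Uᵀ) * (Φ - Z * Zᵀ * Φ)) ≤ frobSq (Φ - Z * Zᵀ * Φ) :=
    MJSReduction.frobSq_one_sub_mul_le (mul_transpose_symm U) (mul_transpose_idem hU) _
  -- `(1 - U Uᵀ) P Φ` is the difference of two matrices, each of squared norm at most that of `Φ - P
  -- Φ`; this produces the constant 4.
  have h3 := frobSq_sub_le ((1 - U * Uᵀ) * Φ) ((1 - U * Uᵀ) * (Φ - Z * Zᵀ * Φ))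
  rw [← Matrix.mul_sub, sub_sub_cancel] at h3
  have h4 := singularValue_sq_mul_frobSq_le (Z * Zᵀ * Φ) (mul_transpose_symm Z)
    (by rw [← Matrix.mul_assoc, mul_transpose_idem hZ])
    (by
      rw [hrank]
      exact (Matrix.rank_mul_le_left _ _).trans
        ((Matrix.rank_le_card_width _).trans_eq (Fintype.card_fin r)))
    (1 - U * Uᵀ)
  rw [hrank] at h4
  linarith

end TopSingularVectors

/-! ### Distances between two projections of equal rank. -/

section Projections

variable {s r : ℕ} {U Z : Matrix (Fin s) (Fin r) ℝ}

/-- With its two successors, this expresses the spectral error, the k-means cost of the true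
partition and the distance of the projections through one trace. -/
theorem frobSq_one_sub_proj_mul_proj (hU : Uᵀ * U = 1) (hZ : Zᵀ * Z = 1) :
    frobSq ((1 - U * Uᵀ) * (Z * Zᵀ)) = r - (U * Uᵀ * (Z * Zᵀ)).trace := by
  rw [frobSq_one_sub_mul (mul_transpose_symm U) (mul_transpose_idem hU), frobSq_eq_trace,
    mul_transpose_symm, mul_transpose_idem hZ, trace_mul_transpose hZ]

theorem frobSq_one_sub_proj_mul (hU : Uᵀ * U = 1) (hZ : Zᵀ * Z = 1) :
    frobSq ((1 - Z * Zᵀ) * U) = r - (U * Uᵀ * (Z * Zᵀ)).trace := by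
  rw [frobSq_one_sub_mul (mul_transpose_symm Z) (mul_transpose_idem hZ), frobSq_eq_trace,
    trace_mul_transpose hU, Matrix.trace_mul_comm (Z * Zᵀ)]

theorem frobSq_proj_sub_proj (hU : Uᵀ * U = 1) (hZ : Zᵀ * Z = 1) :
    frobSq (U * Uᵀ - Z * Zᵀ) = 2 * (r - (U * Uᵀ * (Z * Zᵀ)).trace) := by
  rw [frobSq_eq_trace, Matrix.transpose_sub, mul_transpose_symm, mul_transpose_symm,
    Matrix.sub_mul, Matrix.mul_sub, Matrix.mul_sub, mul_transpose_idem hU, mul_transpose_idem hZ]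
  simp only [Matrix.trace_sub]
  rw [trace_mul_transpose hU, trace_mul_transpose hZ, Matrix.trace_mul_comm (Z * Zᵀ)]
  ring

end Projections

/-! ### Partitions, cluster projections and the k-means cost as a Frobenius distance. -/

section Partition

variable {s r d : ℕ} {κ : Type*} {Ω : Fin r → Finset (Fin s)}

theorem IsPartition.eq_of_mem (hΩ : IsPartition Ω) {i : Fin s} {k l : Fin r} (hk : i ∈ Ω k)
    (hl : i ∈ Ω l) : k = l := by
  by_contra h
  exact disjoint_left.1 (hΩ.disjoint k l h) hk hl

theorem IsPartition.mem_iff_eq (hΩ : IsPartition Ω) {i : Fin s} {k l : Fin r} (hk : i ∈ Ω k) :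
    i ∈ Ω l ↔ l = k :=
  ⟨fun h => hΩ.eq_of_mem h hk, fun h => h ▸ hk⟩

theorem IsPartition.sum_sum_eq (hΩ : IsPartition Ω) (f : Fin s → ℝ) :
    ∑ k, ∑ i ∈ Ω k, f i = ∑ i, f i := by
  rw [← sum_biUnion fun k _ l _ h => hΩ.disjoint k l h]
  congr 1
  ext i
  simpa using hΩ.cover i

theorem IsPartition.card_pos (hΩ : IsPartition Ω) (k : Fin r) : (0 : ℝ) < (Ω k).card :=
  Nat.cast_pos.2 (hΩ.nonempty k).card_pos

theorem card_le_maxClusterCard (Ω : Fin r → Finset (Fin s)) (k : Fin r) :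
    (Ω k).card ≤ maxClusterCard Ω :=
  le_ciSup (Set.finite_range fun k => (Ω k).card).bddAbove k

theorem minClusterCard_le_card (Ω : Fin r → Finset (Fin s)) (k : Fin r) :
    minClusterCard Ω ≤ (Ω k).card :=
  ciInf_le (Set.finite_range fun k => (Ω k).card).bddBelow k

theorem IsPartition.maxClusterCard_pos (hΩ : IsPartition Ω) (k : Fin r) :
    (0 : ℝ) < maxClusterCard Ω :=
  (hΩ.card_pos k).trans_le (Nat.cast_le.2 (card_le_maxClusterCard Ω k))

/-- The matrix whose columns are the normalized indicators of the clusters. -/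
noncomputable def clusterMatrix (Ω : Fin r → Finset (Fin s)) : Matrix (Fin s) (Fin r) ℝ :=
  Matrix.of fun i k => if i ∈ Ω k then (√((Ω k).card : ℝ))⁻¹ else 0

theorem IsPartition.clusterMatrix_transpose_mul_self (hΩ : IsPartition Ω) :
    (clusterMatrix Ω)ᵀ * clusterMatrix Ω = 1 := by
  ext k l
  rw [Matrix.mul_apply, Matrix.one_apply]
  simp only [clusterMatrix, Matrix.transpose_apply, Matrix.of_apply]
  split_ifs with h
  · subst h
    have hc := hΩ.card_pos k
    have : ∀ i, (if i ∈ Ω k then (√((Ω k).card : ℝ))⁻¹ else 0) *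
        (if i ∈ Ω k then (√((Ω k).card : ℝ))⁻¹ else 0) =
        if i ∈ Ω k then ((Ω k).card : ℝ)⁻¹ else 0 := fun i => by
      split_ifs
      · rw [← mul_inv, Real.mul_self_sqrt hc.le]
      · simp
    simp only [this, sum_ite_mem, univ_inter, sum_const, nsmul_eq_mul]
    exact mul_inv_cancel₀ hc.ne'
  · refine sum_eq_zero fun i _ => ?_
    by_cases hk : i ∈ Ω k
    · rw [if_neg fun hl => h (hΩ.eq_of_mem hk hl), mul_zero]
    · rw [if_neg hk, zero_mul]

theorem clusterMatrix_mul_transpose_apply (Ω : Fin r → Finset (Fin s)) (i j : Fin s) :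
    (clusterMatrix Ω * (clusterMatrix Ω)ᵀ) i j =
      ∑ k, if i ∈ Ω k then (if j ∈ Ω k then ((Ω k).card : ℝ)⁻¹ else 0) else 0 := by
  rw [Matrix.mul_apply]
  refine sum_congr rfl fun k _ => ?_
  simp only [clusterMatrix, Matrix.transpose_apply, Matrix.of_apply]
  split_ifs
  · rw [← mul_inv, Real.mul_self_sqrt (Nat.cast_nonneg _)]
  all_goals simp

theorem clusterMatrix_mul_transpose_mul (Ω : Fin r → Finset (Fin s)) (Φ : Matrix (Fin s) κ ℝ) :
    clusterMatrix Ω * (clusterMatrix Ω)ᵀ * Φ = averagedMatrix Ω Φ := by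
  ext i j
  rw [Matrix.mul_apply, averagedMatrix, Matrix.of_apply]
  simp only [clusterMatrix_mul_transpose_apply, sum_mul]
  rw [sum_comm]
  refine sum_congr rfl fun k _ => ?_
  split_ifs
  · simp [mul_sum, ite_mul, sum_ite_mem]
  · simp

theorem IsPartition.clusterMatrix_mul_transpose_apply (hΩ : IsPartition Ω) {i : Fin s} {k : Fin r}
    (hi : i ∈ Ω k) (j : Fin s) : (clusterMatrix Ω * (clusterMatrix Ω)ᵀ) i j =
      if j ∈ Ω k then ((Ω k).card : ℝ)⁻¹ else 0 := by
  rw [MJSReduction.clusterMatrix_mul_transpose_apply]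
  simp only [hΩ.mem_iff_eq hi]
  simp

theorem IsPartition.averagedMatrix_apply (hΩ : IsPartition Ω) {i : Fin s} {k : Fin r}
    (hi : i ∈ Ω k) (Φ : Matrix (Fin s) κ ℝ) (j : κ) :
    averagedMatrix Ω Φ i j = ((Ω k).card : ℝ)⁻¹ * ∑ i' ∈ Ω k, Φ i' j := by
  rw [averagedMatrix, Matrix.of_apply]
  simp only [hΩ.mem_iff_eq hi]
  simp

/-- Rows of the cluster projection that belong to different clusters are well separated. -/
theorem IsPartition.sum_sq_sub_eq (hΩ : IsPartition Ω) {i j : Fin s} {k l : Fin r} (hkl : k ≠ l)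
    (hi : i ∈ Ω k) (hj : j ∈ Ω l) :
    ∑ m, ((clusterMatrix Ω * (clusterMatrix Ω)ᵀ) i m -
      (clusterMatrix Ω * (clusterMatrix Ω)ᵀ) j m) ^ 2 =
      ((Ω k).card : ℝ)⁻¹ + ((Ω l).card : ℝ)⁻¹ := by
  have hterm : ∀ m, ((clusterMatrix Ω * (clusterMatrix Ω)ᵀ) i m -
      (clusterMatrix Ω * (clusterMatrix Ω)ᵀ) j m) ^ 2 =
      (if m ∈ Ω k then (((Ω k).card : ℝ)⁻¹) ^ 2 else 0) +
        if m ∈ Ω l then (((Ω l).card : ℝ)⁻¹) ^ 2 else 0 := fun m => by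
    rw [hΩ.clusterMatrix_mul_transpose_apply hi, hΩ.clusterMatrix_mul_transpose_apply hj]
    by_cases hk : m ∈ Ω k
    · rw [if_pos hk, if_pos hk, if_neg fun hl => hkl (hΩ.eq_of_mem hk hl),
        if_neg fun hl => hkl (hΩ.eq_of_mem hk hl)]
      ring
    · rw [if_neg hk, if_neg hk]
      split_ifs <;> ring
  have h1 := (hΩ.card_pos k).ne'
  have h2 := (hΩ.card_pos l).ne'
  simp only [hterm, sum_add_distrib, sum_ite_mem, univ_inter, sum_const, nsmul_eq_mul]
  field_simp

theorem IsPartition.frobSq_sub_averagedMatrix_le [Fintype κ] (hΩ : IsPartition Ω)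
    (Φ : Matrix (Fin s) κ ℝ) : frobSq (Φ - averagedMatrix Ω Φ) ≤
      ∑ k, ∑ i ∈ Ω k, ∑ i' ∈ Ω k, ∑ j, (Φ i j - Φ i' j) ^ 2 := by
  rw [frobSq, ← hΩ.sum_sum_eq]
  refine sum_le_sum fun k _ => sum_le_sum fun i hi => ?_
  rw [sum_comm]
  refine sum_le_sum fun j _ => ?_
  have hc := hΩ.card_pos k
  have hc1 : (1 : ℝ) ≤ (Ω k).card := Nat.one_le_cast.2 (hΩ.nonempty k).card_pos
  have hrow : (Φ - averagedMatrix Ω Φ) i j =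
      ((Ω k).card : ℝ)⁻¹ * ∑ i' ∈ Ω k, (Φ i j - Φ i' j) := by
    rw [Matrix.sub_apply, hΩ.averagedMatrix_apply hi, sum_sub_distrib, sum_const, nsmul_eq_mul,
      mul_sub, inv_mul_cancel_left₀ hc.ne']
  -- Cauchy–Schwarz gains a factor `1/|Ω_k|`, which is then bounded by 1.
  have hcs := sq_sum_le_card_mul_sum_sq (s := Ω k) (f := fun i' => Φ i j - Φ i' j)
  have hnn : 0 ≤ ∑ i' ∈ Ω k, (Φ i j - Φ i' j) ^ 2 := sum_nonneg fun _ _ => sq_nonneg _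
  rw [hrow, mul_pow, inv_pow, inv_mul_le_iff₀ (by positivity)]
  refine hcs.trans (mul_le_mul_of_nonneg_right ?_ hnn)
  nlinarith

/-- The matrix whose rows are the centers of the clusters. -/
def centerMatrix (Ω : Fin r → Finset (Fin s)) (c : Fin r → EuclideanSpace ℝ (Fin d)) :
    Matrix (Fin s) (Fin d) ℝ :=
  Matrix.of fun i j => ∑ k, if i ∈ Ω k then c k j else 0

theorem IsPartition.centerMatrix_apply (hΩ : IsPartition Ω) {i : Fin s} {k : Fin r}
    (hi : i ∈ Ω k) (c : Fin r → EuclideanSpace ℝ (Fin d)) : centerMatrix Ω c i = c k := by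
  ext j
  rw [centerMatrix, Matrix.of_apply]
  simp only [hΩ.mem_iff_eq hi]
  simp

theorem IsPartition.kmeansCost_eq (hΩ : IsPartition Ω) (U : Matrix (Fin s) (Fin d) ℝ)
    (c : Fin r → EuclideanSpace ℝ (Fin d)) :
    kmeansCost U Ω c = frobSq (U - centerMatrix Ω c) := by
  rw [kmeansCost, frobSq, ← hΩ.sum_sum_eq]
  refine sum_congr rfl fun k _ => sum_congr rfl fun i hi => ?_
  rw [EuclideanSpace.norm_sq_eq]
  refine sum_congr rfl fun j _ => ?_
  rw [Matrix.sub_apply, hΩ.centerMatrix_apply hi]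
  simp

theorem averagedMatrix_eq_centerMatrix (Ω : Fin r → Finset (Fin s))
    (U : Matrix (Fin s) (Fin d) ℝ) : averagedMatrix Ω U = centerMatrix Ω fun k =>
      WithLp.toLp 2 fun j => ((Ω k).card : ℝ)⁻¹ * ∑ i ∈ Ω k, U i j := rfl

end Partition

/-! ### From row deviations to the misclustering rate. -/

section Misclustering

variable {s r : ℕ} {Ω Ωhat : Fin r → Finset (Fin s)}

theorem misclusteringRate_nonneg (Ω Ωhat : Fin r → Finset (Fin s)) :
    0 ≤ misclusteringRate Ω Ωhat :=
  le_inf' _ _ fun _ _ => sum_nonneg fun _ _ => by positivity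

theorem misclusteringRate_le {S : Finset (Fin s)} (h : Equiv.Perm (Fin r))
    (hS : ∀ k, Ω k \ Ωhat (h k) ⊆ Ω k ∩ S) :
    misclusteringRate Ω Ωhat ≤ ∑ k, ((Ω k ∩ S).card : ℝ) / ((Ω k).card : ℝ) := by
  refine (inf'_le _ (mem_univ h)).trans (sum_le_sum fun k _ => ?_)
  gcongr
  exact hS k

/-- If no estimated cluster meets two true clusters outside of `S` and no true cluster lies
in `S`, then up to relabeling all modes outside of `S` are clustered correctly. -/
theorem IsPartition.exists_perm (hhat : IsPartition Ωhat) {S : Finset (Fin s)}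
    (hne : ∀ k, ∃ i ∈ Ω k, i ∉ S)
    (hsep : ∀ k l m i j, k ≠ l → i ∈ Ω k → i ∉ S → j ∈ Ω l → j ∉ S → i ∈ Ωhat m → j ∉ Ωhat m) :
    ∃ h : Equiv.Perm (Fin r), ∀ k, Ω k \ Ωhat (h k) ⊆ Ω k ∩ S := by
  choose t ht htS using hne
  choose f hf using fun k => hhat.cover (t k)
  -- `f` sends a cluster to the estimated cluster of a good representative; separation makes it
  -- injective, hence a permutation of the labels.
  have hinj : Function.Injective f := fun k l hkl => by
    by_contra hne
    exact hsep k l (f k) _ _ hne (ht k) (htS k) (ht l) (htS l) (hf k) (hkl ▸ hf l)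
  refine ⟨Equiv.ofBijective f (Finite.injective_iff_bijective.1 hinj), fun k i hi => ?_⟩
  rw [Equiv.ofBijective_apply, mem_sdiff] at hi
  refine mem_inter.2 ⟨hi.1, ?_⟩
  by_contra hiS
  obtain ⟨m, hm⟩ := hhat.cover i
  obtain ⟨k', rfl⟩ := Finite.surjective_of_injective hinj m
  by_cases hk : k = k'
  · exact hi.2 (hk ▸ hm)
  · exact hsep k k' _ _ _ hk hi.1 hiS (ht k') (htS k') hm (hf k')

variable {D : Fin s → ℝ}

/-- The modes whose deviation `D` is too large for them to be clustered reliably. -/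
noncomputable def badModes (Ω : Fin r → Finset (Fin s)) (D : Fin s → ℝ) : Finset (Fin s) :=
  {i | ∃ k, i ∈ Ω k ∧ ((Ω k).card : ℝ)⁻¹ + (maxClusterCard Ω : ℝ)⁻¹ ≤ 4 * D i}

theorem IsPartition.mem_badModes (hΩ : IsPartition Ω) {i : Fin s} {k : Fin r} (hi : i ∈ Ω k) :
    i ∈ badModes Ω D ↔ ((Ω k).card : ℝ)⁻¹ + (maxClusterCard Ω : ℝ)⁻¹ ≤ 4 * D i := by
  simp only [badModes, mem_filter, mem_univ, true_and]
  exact ⟨fun ⟨l, hl, h⟩ => hΩ.eq_of_mem hl hi ▸ h, fun h => ⟨k, hi, h⟩⟩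

theorem IsPartition.sum_card_badModes_le (hΩ : IsPartition Ω) (hD : ∀ i, 0 ≤ D i) :
    ∑ k, ((Ω k ∩ badModes Ω D).card : ℝ) * (((Ω k).card : ℝ)⁻¹ + (maxClusterCard Ω : ℝ)⁻¹) ≤
      4 * ∑ i, D i := by
  rw [← hΩ.sum_sum_eq, mul_sum]
  refine sum_le_sum fun k _ => ?_
  rw [← nsmul_eq_mul, mul_sum]
  refine (card_nsmul_le_sum _ (fun i => 4 * D i) _ fun i hi => ?_).trans
    (sum_le_sum_of_subset_of_nonneg inter_subset_left fun i _ _ => by linarith [hD i])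
  rw [mem_inter] at hi
  exact (hΩ.mem_badModes hi.1).1 hi.2

/-- The threshold defining bad modes serves twice: it is low enough that two good modes of different
clusters are never merged, and high enough that the budget on `D` cannot make a whole cluster bad.
-/
theorem IsPartition.misclusteringRate_le_badModes (hΩ : IsPartition Ω) (hhat : IsPartition Ωhat)
    (hD : ∀ i, 0 ≤ D i)
    (hsep : ∀ k l m i j, k ≠ l → i ∈ Ω k → j ∈ Ω l → i ∈ Ωhat m → j ∈ Ωhat m →
      ((Ω k).card : ℝ)⁻¹ + ((Ω l).card : ℝ)⁻¹ ≤ 2 * D i + 2 * D j)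
    (hsum : 4 * ∑ i, D i < ((minClusterCard Ω : ℝ) + maxClusterCard Ω) / maxClusterCard Ω) :
    misclusteringRate Ω Ωhat ≤
      ∑ k, ((Ω k ∩ badModes Ω D).card : ℝ) / ((Ω k).card : ℝ) := by
  have hle : ∀ k, (maxClusterCard Ω : ℝ)⁻¹ ≤ ((Ω k).card : ℝ)⁻¹ := fun k =>
    inv_anti₀ (hΩ.card_pos k) (Nat.cast_le.2 (card_le_maxClusterCard Ω k))
  obtain ⟨h, hh⟩ := hhat.exists_perm (Ω := Ω) (S := badModes Ω D) (fun k => by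
    by_contra! hall
    have hinter : Ω k ∩ badModes Ω D = Ω k := inter_eq_left.2 hall
    have h1 := single_le_sum (f := fun k => ((Ω k ∩ badModes Ω D).card : ℝ) *
      (((Ω k).card : ℝ)⁻¹ + (maxClusterCard Ω : ℝ)⁻¹)) (fun _ _ => by positivity) (mem_univ k)
    have h2 := h1.trans (hΩ.sum_card_badModes_le hD)
    simp only [hinter] at h2
    have hN := hΩ.maxClusterCard_pos k
    have h3 : (minClusterCard Ω : ℝ) ≤ (Ω k).card := Nat.cast_le.2 (minClusterCard_le_card Ω k)
    rw [mul_add, mul_inv_cancel₀ (hΩ.card_pos k).ne'] at h2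
    rw [add_div, div_self hN.ne', div_eq_mul_inv] at hsum
    -- A fully bad cluster would cost `1 + |Ω_k|/max`, but the budget is strictly below `1 +
    -- min/max`.
    linarith [mul_le_mul_of_nonneg_right h3 (inv_nonneg.2 hN.le)])
    (fun k l m i j hkl hi hiS hj hjS him hjm => by
      rw [hΩ.mem_badModes hi, not_le] at hiS
      rw [hΩ.mem_badModes hj, not_le] at hjS
      -- Merging would give `1/|Ω_k| + 1/|Ω_l| < (1/|Ω_k| + 1/|Ω_l|)/2 + 1/max`, impossible since
      -- `1/max` is at most either reciprocal.
      linarith [hsep k l m i j hkl hi hj him hjm, hle k, hle l])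
  exact misclusteringRate_le h hh

theorem IsPartition.misclusteringRate_le_sum (hΩ : IsPartition Ω) (hhat : IsPartition Ωhat)
    (hD : ∀ i, 0 ≤ D i)
    (hsep : ∀ k l m i j, k ≠ l → i ∈ Ω k → j ∈ Ω l → i ∈ Ωhat m → j ∈ Ωhat m →
      ((Ω k).card : ℝ)⁻¹ + ((Ω l).card : ℝ)⁻¹ ≤ 2 * D i + 2 * D j)
    (hsum : 4 * ∑ i, D i < ((minClusterCard Ω : ℝ) + maxClusterCard Ω) / maxClusterCard Ω) :
    misclusteringRate Ω Ωhat ≤ 4 * ∑ i, D i := by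
  refine (hΩ.misclusteringRate_le_badModes hhat hD hsep hsum).trans
    (le_trans (sum_le_sum fun k _ => ?_) (hΩ.sum_card_badModes_le hD))
  rw [div_eq_mul_inv]
  gcongr
  exact le_add_of_nonneg_right (by positivity)

theorem IsPartition.misclusteringRate_eq_zero (hΩ : IsPartition Ω) (hhat : IsPartition Ωhat)
    (hD : ∀ i, 0 ≤ D i)
    (hsep : ∀ k l m i j, k ≠ l → i ∈ Ω k → j ∈ Ω l → i ∈ Ωhat m → j ∈ Ωhat m →
      ((Ω k).card : ℝ)⁻¹ + ((Ω l).card : ℝ)⁻¹ ≤ 2 * D i + 2 * D j)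
    (hsum : 4 * ∑ i, D i < 1 / maxClusterCard Ω) :
    misclusteringRate Ω Ωhat = 0 := by
  refine le_antisymm ?_ (misclusteringRate_nonneg Ω Ωhat)
  have hbad : badModes Ω D = ∅ := eq_empty_of_forall_notMem fun i hi => by
    obtain ⟨k, hk⟩ := hΩ.cover i
    rw [hΩ.mem_badModes hk] at hi
    have h1 := single_le_sum (f := D) (fun j _ => hD j) (mem_univ i)
    have h2 : (0 : ℝ) < ((Ω k).card : ℝ)⁻¹ := inv_pos.2 (hΩ.card_pos k)
    rw [one_div] at hsum
    linarith
  have h := hΩ.misclusteringRate_le_badModes hhat hD hsep (hsum.trans_le ?_)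
  · simpa [hbad] using h
  -- A zero maximum makes both quotients zero by the division convention.
  · rcases Nat.eq_zero_or_pos (maxClusterCard Ω) with h0 | h0
    · simp [h0]
    · gcongr
      have : (1 : ℝ) ≤ maxClusterCard Ω := Nat.one_le_cast.2 h0
      linarith [Nat.cast_nonneg (α := ℝ) (minClusterCard Ω)]

end Misclustering

/-! ### Distance of the feature matrix from its cluster average. -/

section Features

variable {n p s r : ℕ}

theorem sum_sum_sum_sq_le {Ω : Fin r → Finset (Fin s)} {f : Fin s → Fin s → ℝ} {b : ℝ}
    (hf : ∀ i j, 0 ≤ f i j) (hb : ∑ k, ∑ i ∈ Ω k, ∑ j ∈ Ω k, f i j ≤ b) :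
    ∑ k, ∑ i ∈ Ω k, ∑ j ∈ Ω k, f i j ^ 2 ≤ b ^ 2 := by
  have h0 : ∀ k i, 0 ≤ ∑ j ∈ Ω k, f i j := fun k i => sum_nonneg fun j _ => hf i j
  have h1 : ∀ k, 0 ≤ ∑ i ∈ Ω k, ∑ j ∈ Ω k, f i j := fun k => sum_nonneg fun i _ => h0 k i
  calc ∑ k, ∑ i ∈ Ω k, ∑ j ∈ Ω k, f i j ^ 2
      ≤ ∑ k, ∑ i ∈ Ω k, (∑ j ∈ Ω k, f i j) ^ 2 := sum_le_sum fun k _ => sum_le_sum fun i _ =>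
        sum_sq_le_sq_sum_of_nonneg fun j _ => hf i j
    _ ≤ ∑ k, (∑ i ∈ Ω k, ∑ j ∈ Ω k, f i j) ^ 2 := sum_le_sum fun k _ =>
        sum_sq_le_sq_sum_of_nonneg fun i _ => h0 k i
    _ ≤ (∑ k, ∑ i ∈ Ω k, ∑ j ∈ Ω k, f i j) ^ 2 := sum_sq_le_sq_sum_of_nonneg fun k _ => h1 k
    _ ≤ b ^ 2 := pow_le_pow_left₀ (sum_nonneg fun k _ => h1 k) hb 2

open scoped Matrix.Norms.Frobenius in
theorem sum_sum_sq_eq_norm_sq {m κ : Type*} [Fintype m] [Fintype κ] (M : Matrix m κ ℝ) :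
    ∑ i, ∑ j, M i j ^ 2 = ‖M‖ ^ 2 := by
  rw [Matrix.frobenius_norm_def, ← Real.sqrt_eq_rpow, Real.sq_sqrt]
  · simp
  · exact sum_nonneg fun _ _ => sum_nonneg fun _ _ => by positivity

open scoped Matrix.Norms.Frobenius in
theorem sum_sq_featureMatrix_sub_le (S : MJS n p s) (αA αB αT : ℝ) (i i' : Fin s) :
    ∑ j, (featureMatrix S αA αB αT i j - featureMatrix S αA αB αT i' j) ^ 2 ≤
      αA ^ 2 * ‖S.A i - S.A i'‖ ^ 2 + αB ^ 2 * ‖S.B i - S.B i'‖ ^ 2 +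
        αT ^ 2 * (∑ j, |S.T i j - S.T i' j|) ^ 2 := by
  have hT : ∑ j, (S.T i j - S.T i' j) ^ 2 ≤ (∑ j, |S.T i j - S.T i' j|) ^ 2 := by
    simpa using sum_sq_le_sq_sum_of_nonneg (s := univ) (f := fun j => |S.T i j - S.T i' j|)
      fun _ _ => abs_nonneg _
  have hT' := mul_le_mul_of_nonneg_left hT (sq_nonneg αT)
  -- `Matrix.vec` indexes by column first, so the double sums are swapped to match.
  rw [← sum_sum_sq_eq_norm_sq, ← sum_sum_sq_eq_norm_sq, sum_comm (γ := Fin n),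
    sum_comm (s := univ) (t := univ) (f := fun a b => (S.B i - S.B i') a b ^ 2)]
  simp only [featureMatrix, Matrix.of_apply, Fintype.sum_sum_type, Sum.elim_inl, Sum.elim_inr,
    Fintype.sum_prod_type, Pi.smul_apply, smul_eq_mul, Matrix.vec, ← mul_sub, mul_pow, ← mul_sum,
    Matrix.sub_apply]
  linarith

open scoped Matrix.Norms.Frobenius in
theorem IsAggregatableCase.frobSq_sub_averagedMatrix_le {S : MJS n p s}
    {Ω : Fin r → Finset (Fin s)} {εA εB εT : ℝ} (hS : IsAggregatableCase S Ω εA εB εT)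
    (αA αB αT : ℝ) :
    frobSq (featureMatrix S αA αB αT - averagedMatrix Ω (featureMatrix S αA αB αT)) ≤
      epsAgg αA αB αT εA εB εT ^ 2 := by
  refine (hS.isPartition.frobSq_sub_averagedMatrix_le _).trans
    ((sum_le_sum fun k _ => sum_le_sum fun i _ => sum_le_sum fun i' _ =>
      sum_sq_featureMatrix_sub_le S αA αB αT i i').trans ?_)
  rw [epsAgg, Real.sq_sqrt (by positivity)]
  simp only [sum_add_distrib, ← mul_sum]
  gcongr
  · exact sum_sum_sum_sq_le (fun _ _ => norm_nonneg _) hS.bound_A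
  · exact sum_sum_sum_sq_le (fun _ _ => norm_nonneg _) hS.bound_B
  · exact sum_sum_sum_sq_le (fun _ _ => sum_nonneg fun _ _ => abs_nonneg _) hS.bound_T

end Features

/-! ### Deviation of the embedded centers from the cluster projection. -/

section Deviation

variable {s r : ℕ} {Ω Ωhat : Fin r → Finset (Fin s)} {U : Matrix (Fin s) (Fin r) ℝ} {ε : ℝ}
  {c : Fin r → EuclideanSpace ℝ (Fin r)}

/-- The estimated centers, embedded by `Uᵀ`, are close to the rows of the cluster projection. -/
theorem IsPartition.frobSq_centerMatrix_le (hΩ : IsPartition Ω) (hU : Uᵀ * U = 1) (hε : 0 ≤ ε)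
    (hkm : IsApproxKMeans ε U Ωhat c) :
    frobSq (centerMatrix Ωhat c * Uᵀ - clusterMatrix Ω * (clusterMatrix Ω)ᵀ) ≤
      3 * (2 + ε) * frobSq ((1 - U * Uᵀ) * (clusterMatrix Ω * (clusterMatrix Ω)ᵀ)) := by
  have hZ := hΩ.clusterMatrix_transpose_mul_self
  set δ := frobSq ((1 - U * Uᵀ) * (clusterMatrix Ω * (clusterMatrix Ω)ᵀ)) with hδ
  have h0 : 0 ≤ δ := frobSq_nonneg _
  -- The competitor is the true partition with the cluster means of `U`; its cost `‖(1 - P) U‖²`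
  -- equals `δ`.
  have h1 : frobSq (U - centerMatrix Ωhat c) ≤ (1 + ε) * δ := by
    rw [hδ, ← hkm.1.kmeansCost_eq, frobSq_one_sub_proj_mul_proj hU hZ,
      ← frobSq_one_sub_proj_mul hU hZ, Matrix.sub_mul, Matrix.one_mul,
      clusterMatrix_mul_transpose_mul, averagedMatrix_eq_centerMatrix, ← hΩ.kmeansCost_eq]
    exact hkm.2 _ _ hΩ
  have h2 : frobSq (U * Uᵀ - clusterMatrix Ω * (clusterMatrix Ω)ᵀ) = 2 * δ := by
    rw [frobSq_proj_sub_proj hU hZ, hδ, frobSq_one_sub_proj_mul_proj hU hZ]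
  -- `C Uᵀ - P = (U Uᵀ - P) - (U - C) Uᵀ`, giving `2 * 2δ + 2 (1 + ε) δ ≤ 3 (2 + ε) δ`.
  have h3 := frobSq_sub_le (U * Uᵀ - clusterMatrix Ω * (clusterMatrix Ω)ᵀ)
    ((U - centerMatrix Ωhat c) * Uᵀ)
  rw [frobSq_mul_transpose_of_transpose_mul_self hU, Matrix.sub_mul, sub_sub_sub_cancel_left]
    at h3
  nlinarith

/-- The rows of two modes in the same estimated cluster but in different true clusters cannot
both be close to the corresponding rows of the cluster projection. -/
theorem IsPartition.inv_card_add_inv_card_le (hΩ : IsPartition Ω) (hhat : IsPartition Ωhat)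
    {k l m : Fin r} {i j : Fin s} (hkl : k ≠ l) (hi : i ∈ Ω k) (hj : j ∈ Ω l)
    (him : i ∈ Ωhat m) (hjm : j ∈ Ωhat m) (V : Matrix (Fin r) (Fin s) ℝ) :
    ((Ω k).card : ℝ)⁻¹ + ((Ω l).card : ℝ)⁻¹ ≤
      2 * ∑ t, (centerMatrix Ωhat c * V - clusterMatrix Ω * (clusterMatrix Ω)ᵀ) i t ^ 2 +
      2 * ∑ t, (centerMatrix Ωhat c * V - clusterMatrix Ω * (clusterMatrix Ω)ᵀ) j t ^ 2 := by
  rw [← hΩ.sum_sq_sub_eq hkl hi hj, mul_sum, mul_sum, ← sum_add_distrib]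
  refine sum_le_sum fun t _ => ?_
  have hrow : (centerMatrix Ωhat c * V) i t = (centerMatrix Ωhat c * V) j t := by
    simp only [Matrix.mul_apply, hhat.centerMatrix_apply him, hhat.centerMatrix_apply hjm]
  rw [Matrix.sub_apply, Matrix.sub_apply, hrow]
  generalize (centerMatrix Ωhat c * V) j t = z
  generalize (clusterMatrix Ω * (clusterMatrix Ω)ᵀ) i t = x
  generalize (clusterMatrix Ω * (clusterMatrix Ω)ᵀ) j t = y
  nlinarith [sq_nonneg (2 * z - x - y)]

end Deviation

end MJSReduction

theorem theorem1 {n p s r : ℕ} (S : MJS n p s)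
    (Ω : Fin r → Finset (Fin s)) (εA εB εT : ℝ)
    (hS : IsAggregatableCase S Ω εA εB εT)
    (αA αB αT : ℝ) (hαA : 0 ≤ αA) (hαB : 0 ≤ αB) (hαT : 0 ≤ αT) (hα : αA + αB + αT = 1)
    (ε : ℝ) (hε : 0 ≤ ε)
    (U : Matrix (Fin s) (Fin r) ℝ) (Ωhat : Fin r → Finset (Fin s))
    (c : Fin r → EuclideanSpace ℝ (Fin r))
    (hAlg : IsAlgorithmOutput S αA αB αT ε U Ωhat c)
    (hrank : (averagedMatrix Ω (featureMatrix S αA αB αT)).rank = r) :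
    (epsAgg αA αB αT εA εB εT ≤
        singularValue (averagedMatrix Ω (featureMatrix S αA αB αT)) r *
          √((minClusterCard Ω : ℝ) + (maxClusterCard Ω : ℝ)) /
          (8 * √((2 + ε) * (maxClusterCard Ω : ℝ))) →
      misclusteringRate Ω Ωhat ≤
        64 * (2 + ε) *
          ((singularValue (averagedMatrix Ω (featureMatrix S αA αB αT)) r) ^ 2)⁻¹ *
          epsAgg αA αB αT εA εB εT ^ 2) ∧
    (epsAgg αA αB αT εA εB εT ≤
        singularValue (averagedMatrix Ω (featureMatrix S αA αB αT)) r /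
          (8 * √((2 + ε) * (maxClusterCard Ω : ℝ))) →
      misclusteringRate Ω Ωhat = 0) := by
  -- Without clusters the rate is an empty sum.
  rcases Nat.eq_zero_or_pos r with rfl | hr
  · have h0 : misclusteringRate Ω Ωhat = 0 := by simp [misclusteringRate]
    exact ⟨fun _ => h0 ▸ by positivity, fun _ => h0⟩
  have hΩ := hS.isPartition
  have hhat := hAlg.kmeans.1
  have hU := hAlg.singularVectors.transpose_mul_self
  have hN := hΩ.maxClusterCard_pos ⟨0, hr⟩
  have hσ : 0 < singularValue (averagedMatrix Ω (featureMatrix S αA αB αT)) r := by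
    have h := singularValue_rank_pos (averagedMatrix Ω (featureMatrix S αA αB αT))
    rw [hrank] at h
    exact h hr
  have hsin := hAlg.singularVectors.frobSq_one_sub_mul_le hr hΩ.clusterMatrix_transpose_mul_self
    (by rw [clusterMatrix_mul_transpose_mul, hrank])
  rw [clusterMatrix_mul_transpose_mul] at hsin
  have hE := hS.frobSq_sub_averagedMatrix_le αA αB αT
  have hdev := hΩ.frobSq_centerMatrix_le hU hε hAlg.kmeans
  let D : Fin s → ℝ := fun i =>
    ∑ t, (centerMatrix Ωhat c * U.transpose -
      clusterMatrix Ω * (clusterMatrix Ω).transpose) i t ^ 2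
  have hD : ∀ i, 0 ≤ D i := fun i => Finset.sum_nonneg fun _ _ => sq_nonneg _
  have hsep : ∀ k l m i j, k ≠ l → i ∈ Ω k → j ∈ Ω l → i ∈ Ωhat m → j ∈ Ωhat m →
      ((Ω k).card : ℝ)⁻¹ + ((Ω l).card : ℝ)⁻¹ ≤ 2 * D i + 2 * D j :=
    fun k l m i j hkl hi hj him hjm => hΩ.inv_card_add_inv_card_le hhat hkl hi hj him hjm _
  change ∑ i, D i ≤ _ at hdev
  have hη : 0 ≤ epsAgg αA αB αT εA εB εT := Real.sqrt_nonneg _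
  generalize singularValue (averagedMatrix Ω (featureMatrix S αA αB αT)) r = σ at *
  generalize epsAgg αA αB αT εA εB εT = η at *
  generalize frobSq ((1 - U * U.transpose) * (clusterMatrix Ω * (clusterMatrix Ω).transpose)) = δ
    at *
  have hσ2 : 0 < σ ^ 2 := by positivity
  -- The constant is `4 * 3 * 4 = 48 = 3/4 * 64`; the spare factor `3/4` turns the non-strict
  -- hypotheses into the strict bounds required on `∑ D i`.
  have hB : 4 * ∑ i, D i ≤ 3 / 4 * (64 * (2 + ε) * (σ ^ 2)⁻¹ * η ^ 2) := by
    have hδ : δ ≤ (σ ^ 2)⁻¹ * (4 * η ^ 2) := by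
      rw [le_inv_mul_iff₀ hσ2]
      linarith
    nlinarith [mul_le_mul_of_nonneg_left hδ (by linarith : 0 ≤ 12 * (2 + ε))]
  -- Both smallness conditions have this form, with `b = min + max` and `b = 1`.
  have hcond : ∀ b : ℝ, 0 ≤ b → η ≤ σ * √b / (8 * √((2 + ε) * (maxClusterCard Ω : ℝ))) →
      64 * (2 + ε) * (σ ^ 2)⁻¹ * η ^ 2 ≤ b / maxClusterCard Ω := fun b hb h => by
    have h2 := pow_le_pow_left₀ hη h 2
    rw [div_pow, mul_pow, mul_pow, Real.sq_sqrt hb, Real.sq_sqrt (by positivity)] at h2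
    have hε2 : 0 < 2 + ε := by linarith
    calc 64 * (2 + ε) * (σ ^ 2)⁻¹ * η ^ 2
        ≤ 64 * (2 + ε) * (σ ^ 2)⁻¹ *
          (σ ^ 2 * b / (8 ^ 2 * ((2 + ε) * (maxClusterCard Ω : ℝ)))) := by gcongr
      _ = b / maxClusterCard Ω := by
        field_simp
        ring
  have hB0 : 0 ≤ 64 * (2 + ε) * (σ ^ 2)⁻¹ * η ^ 2 := by positivity
  refine ⟨fun h => ?_, fun h => ?_⟩
  · have h1 := hcond _ (by positivity) h
    have hpos : 0 < ((minClusterCard Ω : ℝ) + maxClusterCard Ω) / maxClusterCard Ω := by positivity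
    exact (hΩ.misclusteringRate_le_sum hhat hD hsep (by linarith)).trans (by linarith)
  · have h1 := hcond 1 zero_le_one (by simpa using h)
    have hpos : 0 < 1 / (maxClusterCard Ω : ℝ) := by positivity
    exact hΩ.misclusteringRate_eq_zero hhat hD hsep (by linarith)
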